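/- **Irregular channel polarization.** A binary-input discrete memoryless channel (B-DMC) $W$ with finite output alphabet $\mathcal Y$ is given by transition probabilities $W(y\mid x)$, $x\in\{0,1\}$, $y\in\mathcal Y$; its symmetric capacity is the mutual information (in bits) between a uniform input and the output, $$I(W)=\sum_{y\in\mathcal Y}\sum_{x\in\{0,1\}}\tfrac12 W(y\mid x)\log_2\frac{W(y\mid x)}{\tfrac12W(y\mid 0)+\tfrac12W(y\mid 1)}\in[0,1].$$ Let $N=2^n$ and $\mathbf G_N=\mathbf R\,\mathbf F^{\otimes n}$ over $\mathbb F_2$, where $\mathbf F=\begin{bmatrix}1&0\\1&1\end{bmatrix}$ and $\mathbf R$ is the $N\times N$ bit-reversal permutation matrix. Given B-DMCs $W^1,\dots,W^N$ with $W^i:\{0,1\}\to\mathcal Y_i$, used independently, put $W_N(y^{1:N}\mid u^{1:N})=\prod_{i=1}^N W^i\big(y^i\mid (u^{1:N}\mathbf G_N)_i\big)$, and define the synthesized channels, for $1\le i\le N$, by $$W_N^{(i)}(y^{1:N},u^{1:i-1}\mid u^i)=\sum_{u^{i+1:N}\in\{0,1\}^{N-i}}\frac1{2^{N-1}}W_N(y^{1:N}\mid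 u^{1:N}).$$ Let $\mathbb A[I(W^{1:N})]=\frac1N\sum_{i=1}^N I(W^i)$. For every $n\ge 0$ let $W^{1:N}=W^{1:N}_{[n]}$ be an arbitrary family of $N=2^n$ B-DMCs with finite output alphabets; the channels may have different transition probabilities and different output alphabets, and the families for different $n$ need not be related. Then for every fixed $\delta\in(0,1)$, as $N=2^n\to\infty$, $$\frac{\#\{i: I(W_N^{(i)})\in(1-\delta,1]\}}{N}-\mathbb A[I(W^{1:N})]\to0,\qquad \frac{\#\{i: I(W_N^{(i)})\in[0,\delta)\}}{N}-\big(1-\mathbb A[I(W^{1:N})]\big)\to0.$$ In other words, the law of $I(W_N^{(i)})$ for uniformly random $i$ is asymptotically that of a random variable equal to $1$ with probability $\mathbb A[I(W^{1:N})]$ and to $0$ otherwise: for every continuous $g:[0,1]\to\mathbb R$, $$\frac1N\sum_{i=1}^N g\big(I(W_N^{(i)})\big)-\Big(\mathbb A[I(W^{1:N})]\,g(1)+\big(1-\mathbb A[I(W^{1:N})]\big)g(0)\Big)\to0 .$$ -/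

import Mathlib

open scoped Matrix

namespace IrregularPolar

/-- A binary-input discrete memoryless channel with finite output alphabet `Y`:
`W.prob x y` is the transition probability `W(y | x)`. The input alphabet `{0, 1}` with addition
mod 2 is `ZMod 2`. -/
structure BDMC (Y : Type*) [Fintype Y] where
  prob : ZMod 2 → Y → ℝ
  nonneg : ∀ x y, 0 ≤ prob x y
  sum_eq_one : ∀ x, ∑ y, prob x y = 1

/-- The symmetric capacity `I(W)` in bits: the mutual information between a uniformly distributed
input and the output. -/
noncomputable def BDMC.symmCapacity {Y : Type*} [Fintype Y] (W : BDMC Y) : ℝ :=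
  ∑ y, ∑ x, (1 / 2 : ℝ) * W.prob x y *
    Real.logb 2 (W.prob x y / (∑ x', (1 / 2 : ℝ) * W.prob x' y))

/-- The kernel `F`. -/
def kernelF : Matrix (Fin 2) (Fin 2) (ZMod 2) := !![1, 0; 1, 1]

/-- Binary digits of an index; `bits i k` is the coefficient of `2 ^ k`. -/
def bits {n : ℕ} : Fin (2 ^ n) ≃ (Fin n → Fin 2) := finFunctionFinEquiv.symm

/-- The Kronecker power `F^{⊗ n}`, entrywise: the `(i, j)` entry is the product over all digit
positions of the entries of `F` at the digits of `i` and `j`. -/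
def kroneckerPowF (n : ℕ) : Matrix (Fin (2 ^ n)) (Fin (2 ^ n)) (ZMod 2) :=
  Matrix.of fun i j => ∏ k : Fin n, kernelF (bits i k) (bits j k)

/-- The permutation of the indices that reverses the order of the `n` binary digits. -/
def bitReversal (n : ℕ) : Equiv.Perm (Fin (2 ^ n)) :=
  bits.trans ((Equiv.arrowCongr Fin.revPerm (Equiv.refl (Fin 2))).trans bits.symm)

/-- The polar transform `G_N = R F^{⊗ n}`, `N = 2 ^ n`, with `R` the bit-reversal matrix. -/
def polarMatrix (n : ℕ) : Matrix (Fin (2 ^ n)) (Fin (2 ^ n)) (ZMod 2) :=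
  (bitReversal n).permMatrix (ZMod 2) * kroneckerPowF n

section Transform

variable {n : ℕ} {Y : Fin (2 ^ n) → Type*} [∀ i, Fintype (Y i)]

/-- Channel combining: `W_N(y | u) = ∏ i, W^i(y_i | (u G_N)_i)`. -/
def combined (W : (i : Fin (2 ^ n)) → BDMC (Y i)) (u : Fin (2 ^ n) → ZMod 2)
    (y : (i : Fin (2 ^ n)) → Y i) : ℝ :=
  ∏ i, (W i).prob ((u ᵥ* polarMatrix n) i) (y i)

/-- Transition probability of the `i`-th split channel,
`W_N^{(i)}(y, u_{<i} | u_i) = ∑_{u_{>i}} 2^{-(N-1)} W_N(y | u)`. -/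
noncomputable def splitProb (W : (i : Fin (2 ^ n)) → BDMC (Y i)) (i : Fin (2 ^ n)) (x : ZMod 2)
    (o : ((j : Fin (2 ^ n)) → Y j) × ({j : Fin (2 ^ n) // j < i} → ZMod 2)) : ℝ :=
  ∑ u : Fin (2 ^ n) → ZMod 2 with u i = x ∧ (fun j : {j // j < i} => u j) = o.2,
    1 / 2 ^ (2 ^ n - 1) * combined W u o.1

theorem combined_nonneg (W : (i : Fin (2 ^ n)) → BDMC (Y i)) (u : Fin (2 ^ n) → ZMod 2)
    (y : (i : Fin (2 ^ n)) → Y i) : 0 ≤ combined W u y :=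
  Finset.prod_nonneg fun i _ => (W i).nonneg _ _

theorem sum_combined (W : (i : Fin (2 ^ n)) → BDMC (Y i)) (u : Fin (2 ^ n) → ZMod 2) :
    ∑ y, combined W u y = 1 := by
  classical
  unfold combined
  rw [← Fintype.prod_sum (fun i y => (W i).prob ((u ᵥ* polarMatrix n) i) y)]
  simp [BDMC.sum_eq_one]

theorem card_fix (i : Fin (2 ^ n)) (x : ZMod 2) :
    (Finset.univ.filter fun u : Fin (2 ^ n) → ZMod 2 => u i = x).card = 2 ^ (2 ^ n - 1) := by
  have h : (Finset.univ.filter fun u : Fin (2 ^ n) → ZMod 2 => u i = x)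
      = Fintype.piFinset (fun j => if j = i then {x} else Finset.univ) := by
    ext u
    simp only [Finset.mem_filter, Finset.mem_univ, true_and, Fintype.mem_piFinset]
    constructor
    · intro hu j
      split_ifs with hj
      · subst hj; simpa using hu
      · simp
    · intro hu
      simpa using hu i
  rw [h, Fintype.card_piFinset]
  have h2 : ∀ j, (if j = i then ({x} : Finset (ZMod 2)) else Finset.univ).card
      = if j = i then 1 else 2 := by
    intro j
    split_ifs <;> simp [ZMod.card]
  simp only [h2]
  rw [Finset.prod_ite]
  simp [Finset.filter_ne']

theorem sum_splitProb (W : (i : Fin (2 ^ n)) → BDMC (Y i)) (i : Fin (2 ^ n)) (x : ZMod 2) :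
    ∑ o, splitProb W i x o = 1 := by
  classical
  rw [Fintype.sum_prod_type]
  have h : ∀ y : (j : Fin (2 ^ n)) → Y j, ∑ v, splitProb W i x (y, v)
      = ∑ u : Fin (2 ^ n) → ZMod 2 with u i = x,
          1 / 2 ^ (2 ^ n - 1) * combined W u y := by
    intro y
    simp only [splitProb, ← Finset.filter_filter]
    exact Finset.sum_fiberwise _ _ _
  simp only [h]
  rw [Finset.sum_comm]
  simp only [← Finset.mul_sum, sum_combined]
  rw [Finset.sum_const, card_fix]
  simp

/-- Channel splitting: the synthesized channel `W_N^{(i)}`, with input `u_i` and output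
`(y, u_{<i})`. -/
noncomputable def synthesized (W : (i : Fin (2 ^ n)) → BDMC (Y i)) (i : Fin (2 ^ n)) :
    BDMC (((j : Fin (2 ^ n)) → Y j) × ({j : Fin (2 ^ n) // j < i} → ZMod 2)) where
  prob := splitProb W i
  nonneg x o := Finset.sum_nonneg fun u _ =>
    mul_nonneg (by positivity) (combined_nonneg W u o.1)
  sum_eq_one := sum_splitProb W i

/-- The average `A[I(W^{1:N})]` of the symmetric capacities of the initial channels. -/
noncomputable def averageCapacity (W : (i : Fin (2 ^ n)) → BDMC (Y i)) : ℝ :=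
  (∑ i, (W i).symmCapacity) / 2 ^ n

/-- The fraction of indices `i` for which `I(W_N^{(i)})` lies in `S`. -/
noncomputable def fractionIn (W : (i : Fin (2 ^ n)) → BDMC (Y i)) (S : Set ℝ) : ℝ :=
  ({i : Fin (2 ^ n) | (synthesized W i).symmCapacity ∈ S}.ncard : ℝ) / 2 ^ n

end Transform

end IrregularPolar

/-!
The most significant binary digit of an index splits the initial channels into two blocks, and the
least significant digit selects the check-node combination `minus` or the variable-node combination
`plus` of the corresponding synthesized channels of the two blocks. The two blocks are unrelated, so
the martingale of the regular case is not available. Instead, each combination preserves the sum of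
the capacities, and by a concavity bound on the binary entropy it separates them:
`I⁺ - I⁻ ≥ κ (s(I)² + s(J)²)`, where `s(x) = x (1 - x)`.

Let `Q` be the sum of `s(I(W_N^{(i)}))` over `i`, and `T` the sum of `I(W_N^{(i)})` weighted by the
number of `plus` steps minus the number of `minus` steps. Passing from two blocks to the whole, `Q`
is subadditive while `T` gains all the gaps `I⁺ - I⁻`, whence `κ n Q² ≤ 2ⁿ T` by induction. The
weights have mean square `n`, so `T² ≤ n 4ⁿ` by Cauchy–Schwarz, and the average of `s(I(W_N^{(i)}))`
is `O(n^{-1/4})`. A bounded function continuous at `0` and `1` differs from its linear interpolation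
between these points by at most `ε + C s`, and the average of the interpolation is conserved.
-/

namespace IrregularPolar

section LetterInfo

open Real

theorem negMulLog_le_two_mul_sqrt_sub {x : ℝ} (hx : 0 ≤ x) : negMulLog x ≤ 2 * (√x - x) := by
  rcases hx.eq_or_lt with rfl | hx
  · simp
  · have hlog := log_le_sub_one_of_pos (inv_pos.2 (sqrt_pos.2 hx))
    rw [log_inv, log_sqrt hx.le] at hlog
    have hdiv : x * (√x)⁻¹ = √x := by rw [← div_eq_mul_inv, div_sqrt]
    rw [negMulLog]
    nlinarith

theorem binEntropy_sq_le {p : ℝ} (h0 : 0 ≤ p) (h1 : p ≤ 1) :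
    binEntropy p ^ 2 ≤ 4 * (p * (1 - p)) := by
  have h1' : 0 ≤ 1 - p := sub_nonneg.2 h1
  have hle : binEntropy p ≤ 2 * (√p * √(1 - p)) := by
    have hprod : 0 ≤ (1 - √p) * (1 - √(1 - p)) :=
      mul_nonneg (sub_nonneg.2 (sqrt_le_one.2 h1)) (sub_nonneg.2 (sqrt_le_one.2 (by linarith)))
    rw [binEntropy_eq_negMulLog_add_negMulLog_one_sub]
    linarith [negMulLog_le_two_mul_sqrt_sub h0, negMulLog_le_two_mul_sqrt_sub h1']
  calc binEntropy p ^ 2 ≤ (2 * (√p * √(1 - p))) ^ 2 :=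
        pow_le_pow_left₀ (binEntropy_nonneg h0 h1) hle 2
    _ = 4 * (p * (1 - p)) := by rw [mul_pow, mul_pow, sq_sqrt h0, sq_sqrt h1']; norm_num

-- A linear substitute for Mrs. Gerber's lemma: the argument on the right lies on the segment from
-- `1 / 2` to `p` or `1 - p`, at the fraction `|2 * q - 1|`, so concavity suffices.
theorem le_binEntropy_binary_convolution {p q : ℝ} (hp0 : 0 ≤ p) (hp1 : p ≤ 1) (hq0 : 0 ≤ q)
    (hq1 : q ≤ 1) :
    |2 * q - 1| * binEntropy p + (1 - |2 * q - 1|) * log 2 ≤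
      binEntropy (p * q + (1 - p) * (1 - q)) := by
  wlog hq : 1 / 2 ≤ q generalizing q with H
  · have h := H (sub_nonneg.2 hq1) (sub_le_self 1 hq0) (by linarith)
    rw [show 2 * (1 - q) - 1 = -(2 * q - 1) by ring, abs_neg] at h
    rw [← binEntropy_one_sub (p * q + (1 - p) * (1 - q))]
    refine h.trans_eq (congrArg binEntropy ?_)
    ring
  · rw [abs_of_nonneg (by linarith : 0 ≤ 2 * q - 1), ← binEntropy_two_inv]
    have h := strictConcave_binEntropy.concaveOn.2 ⟨hp0, hp1⟩
      (show (2⁻¹ : ℝ) ∈ Set.Icc 0 1 by norm_num) (by linarith : 0 ≤ 2 * q - 1)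
      (by linarith : 0 ≤ 1 - (2 * q - 1)) (by ring)
    rw [smul_eq_mul, smul_eq_mul, smul_eq_mul, smul_eq_mul] at h
    refine h.trans_eq (congrArg binEntropy ?_)
    ring

/-- The contribution to the symmetric capacity, in bits, of an output letter whose transition
probabilities from the inputs `0` and `1` are `a` and `b`. -/
noncomputable def letterInfo (a b : ℝ) : ℝ :=
  (negMulLog ((a + b) / 2) - (negMulLog a + negMulLog b) / 2) / log 2

theorem letterInfo_eq_logb {a b : ℝ} (ha : 0 ≤ a) (hb : 0 ≤ b) :
    letterInfo a b = 1 / 2 * a * logb 2 (a / (1 / 2 * a + 1 / 2 * b)) +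
      1 / 2 * b * logb 2 (b / (1 / 2 * a + 1 / 2 * b)) := by
  have mul_logb_div {x m : ℝ} (hm : x ≠ 0 → m ≠ 0) :
      x * logb 2 (x / m) = (-negMulLog x - x * log m) / log 2 := by
    rcases eq_or_ne x 0 with rfl | hx
    · simp
    · rw [logb, log_div hx (hm hx), negMulLog]
      ring
  have hma : a ≠ 0 → 1 / 2 * a + 1 / 2 * b ≠ 0 := fun h ↦ by positivity
  have hmb : b ≠ 0 → 1 / 2 * a + 1 / 2 * b ≠ 0 := fun h ↦ by positivity
  rw [mul_assoc, mul_assoc (1 / 2) b, mul_logb_div hma, mul_logb_div hmb, letterInfo,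
    show (a + b) / 2 = 1 / 2 * a + 1 / 2 * b by ring]
  simp only [negMulLog]
  ring

theorem exists_eq_two_mul_mul {a b : ℝ} (ha : 0 ≤ a) (hb : 0 ≤ b) :
    ∃ m p : ℝ, 0 ≤ m ∧ 0 ≤ p ∧ p ≤ 1 ∧ a = 2 * m * p ∧ b = 2 * m * (1 - p) := by
  rcases (add_nonneg ha hb).eq_or_lt with h | h
  · exact ⟨0, 0, le_rfl, le_rfl, zero_le_one, by linarith, by linarith⟩
  · exact ⟨(a + b) / 2, a / (a + b), by positivity, by positivity,
      div_le_one_of_le₀ (by linarith) h.le, by field_simp, by field_simp; ring⟩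

theorem letterInfo_two_mul_mul (m p : ℝ) :
    letterInfo (2 * m * p) (2 * m * (1 - p)) = m * (1 - binEntropy p / log 2) := by
  have hlog : log 2 ≠ 0 := (log_pos one_lt_two).ne'
  have htwo : negMulLog 2 = -2 * log 2 := by simp [negMulLog]
  rw [letterInfo, show (2 * m * p + 2 * m * (1 - p)) / 2 = m by ring,
    negMulLog_mul (2 * m), negMulLog_mul (2 * m), negMulLog_mul 2 m, htwo,
    binEntropy_eq_negMulLog_add_negMulLog_one_sub]
  field_simp
  ring

theorem letterInfo_nonneg {a b : ℝ} (ha : 0 ≤ a) (hb : 0 ≤ b) : 0 ≤ letterInfo a b := by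
  obtain ⟨m, p, hm, -, -, rfl, rfl⟩ := exists_eq_two_mul_mul ha hb
  rw [letterInfo_two_mul_mul]
  exact mul_nonneg hm
    (sub_nonneg.2 (div_le_one_of_le₀ binEntropy_le_log_two (log_pos one_lt_two).le))

theorem letterInfo_le {a b : ℝ} (ha : 0 ≤ a) (hb : 0 ≤ b) : letterInfo a b ≤ (a + b) / 2 := by
  obtain ⟨m, p, hm, hp0, hp1, rfl, rfl⟩ := exists_eq_two_mul_mul ha hb
  have hentropy : 0 ≤ binEntropy p / log 2 :=
    div_nonneg (binEntropy_nonneg hp0 hp1) (log_pos one_lt_two).le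
  rw [letterInfo_two_mul_mul]
  linarith [mul_nonneg hm hentropy]

theorem letterInfo_check_le {a b c d : ℝ} (ha : 0 ≤ a) (hb : 0 ≤ b) (hc : 0 ≤ c) (hd : 0 ≤ d) :
    letterInfo (1 / 2 * (a * c + b * d)) (1 / 2 * (b * c + a * d)) ≤
      letterInfo a b * (|c - d| / 2) := by
  obtain ⟨m, p, hm, hp0, hp1, rfl, rfl⟩ := exists_eq_two_mul_mul ha hb
  obtain ⟨k, q, hk, hq0, hq1, rfl, rfl⟩ := exists_eq_two_mul_mul hc hd
  have hlog : 0 < log 2 := log_pos one_lt_two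
  have hentropy : 1 - binEntropy (p * q + (1 - p) * (1 - q)) / log 2 ≤
      (1 - binEntropy p / log 2) * |2 * q - 1| := by
    have h := le_binEntropy_binary_convolution hp0 hp1 hq0 hq1
    generalize |2 * q - 1| = s at h ⊢
    field_simp
    linarith
  calc letterInfo (1 / 2 * (2 * m * p * (2 * k * q) + 2 * m * (1 - p) * (2 * k * (1 - q))))
        (1 / 2 * (2 * m * (1 - p) * (2 * k * q) + 2 * m * p * (2 * k * (1 - q))))
      = m * k * (1 - binEntropy (p * q + (1 - p) * (1 - q)) / log 2) := by
        rw [← letterInfo_two_mul_mul]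
        congr 1 <;> ring
    _ ≤ m * k * ((1 - binEntropy p / log 2) * |2 * q - 1|) := by gcongr
    _ = letterInfo (2 * m * p) (2 * m * (1 - p)) * (|2 * k * q - 2 * k * (1 - q)| / 2) := by
        rw [letterInfo_two_mul_mul, show 2 * k * q - 2 * k * (1 - q) = 2 * k * (2 * q - 1) by ring,
          abs_mul, abs_of_nonneg (by positivity : 0 ≤ 2 * k)]
        ring

theorem letterInfo_check_add_letterInfo_variable (a b c d : ℝ) :
    letterInfo (1 / 2 * (a * c + b * d)) (1 / 2 * (b * c + a * d)) +
      (letterInfo (1 / 2 * (a * c)) (1 / 2 * (b * d)) +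
        letterInfo (1 / 2 * (b * c)) (1 / 2 * (a * d))) =
    letterInfo a b * ((c + d) / 2) + (a + b) / 2 * letterInfo c d := by
  simp only [letterInfo]
  rw [show (1 / 2 * (a * c + b * d) + 1 / 2 * (b * c + a * d)) / 2 = (a + b) / 2 * ((c + d) / 2)
      by ring,
    show (1 / 2 * (a * c) + 1 / 2 * (b * d)) / 2 = 1 / 2 * (1 / 2 * (a * c + b * d)) by ring,
    show (1 / 2 * (b * c) + 1 / 2 * (a * d)) / 2 = 1 / 2 * (1 / 2 * (b * c + a * d)) by ring]
  simp only [negMulLog_mul (1 / 2) (1 / 2 * _), negMulLog_mul (1 / 2) (_ * _),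
    negMulLog_mul a, negMulLog_mul b, negMulLog_mul ((a + b) / 2)]
  ring

/-- The constant `(log 2)² / 2` of the polarization estimates: it comes from
`binEntropy p ^ 2 ≤ 4 p (1 - p)` once the entropy is measured in bits. -/
noncomputable def gapConst : ℝ := log 2 ^ 2 / 2

theorem gapConst_pos : 0 < gapConst :=
  div_pos (pow_pos (log_pos one_lt_two) 2) two_pos

theorem gapConst_le_quarter : gapConst ≤ 1 / 4 := by
  have h0 := log_pos one_lt_two
  have h1 := log_two_lt_d9
  rw [gapConst]
  nlinarith

theorem gapConst_mul_sq_sub_letterInfo_le {a b : ℝ} (ha : 0 ≤ a) (hb : 0 ≤ b) :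
    gapConst * ((a + b) / 2 - letterInfo a b) ^ 2 ≤
      (a + b) / 2 * ((a + b) / 2 - |a - b| / 2) := by
  obtain ⟨m, p, hm, hp0, hp1, rfl, rfl⟩ := exists_eq_two_mul_mul ha hb
  have habs : |2 * p - 1| ≤ 1 - 2 * (p * (1 - p)) := abs_le.2 ⟨by nlinarith, by nlinarith⟩
  have hlog : log 2 ≠ 0 := (log_pos one_lt_two).ne'
  calc gapConst * ((2 * m * p + 2 * m * (1 - p)) / 2 -
        letterInfo (2 * m * p) (2 * m * (1 - p))) ^ 2
      = m ^ 2 / 2 * binEntropy p ^ 2 := by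
        rw [letterInfo_two_mul_mul, gapConst]
        field_simp
        ring
    _ ≤ m ^ 2 / 2 * (4 * (p * (1 - p))) := by gcongr; exact binEntropy_sq_le hp0 hp1
    _ = m ^ 2 * (2 * (p * (1 - p))) := by ring
    _ ≤ m ^ 2 * (1 - |2 * p - 1|) := by gcongr; linarith
    _ = _ := by
        rw [show 2 * m * p - 2 * m * (1 - p) = 2 * m * (2 * p - 1) by ring,
          abs_mul, abs_of_nonneg (by positivity : 0 ≤ 2 * m)]
        ring

end LetterInfo

section Channel

variable {Y Z : Type*} [Fintype Y] [Fintype Z]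

theorem sum_zmod_two {M : Type*} [AddCommMonoid M] (f : ZMod 2 → M) : ∑ x, f x = f 0 + f 1 :=
  Fin.sum_univ_two f

theorem symmCapacity_eq_sum_letterInfo (W : BDMC Y) :
    W.symmCapacity = ∑ y, letterInfo (W.prob 0 y) (W.prob 1 y) := by
  simp only [BDMC.symmCapacity, sum_zmod_two, letterInfo_eq_logb (W.nonneg _ _) (W.nonneg _ _)]

theorem symmCapacity_eq_of_equiv {V : BDMC Y} {W : BDMC Z} (e : Y ≃ Z)
    (h : ∀ x y, V.prob x y = W.prob x (e y)) : V.symmCapacity = W.symmCapacity := by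
  simp only [BDMC.symmCapacity, h]
  exact e.sum_comp fun z ↦ ∑ x, (1 / 2 : ℝ) * W.prob x z *
    Real.logb 2 (W.prob x z / ∑ x', (1 / 2 : ℝ) * W.prob x' z)

theorem sum_prob_average (W : BDMC Y) : ∑ y, (W.prob 0 y + W.prob 1 y) / 2 = 1 := by
  rw [← Finset.sum_div, Finset.sum_add_distrib, W.sum_eq_one, W.sum_eq_one]
  norm_num

theorem symmCapacity_nonneg (W : BDMC Y) : 0 ≤ W.symmCapacity := by
  rw [symmCapacity_eq_sum_letterInfo]
  exact Finset.sum_nonneg fun y _ ↦ letterInfo_nonneg (W.nonneg _ _) (W.nonneg _ _)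

theorem symmCapacity_le_one (W : BDMC Y) : W.symmCapacity ≤ 1 := by
  rw [symmCapacity_eq_sum_letterInfo, ← sum_prob_average W]
  exact Finset.sum_le_sum fun y _ ↦ letterInfo_le (W.nonneg _ _) (W.nonneg _ _)

theorem symmCapacity_mem_Icc (W : BDMC Y) : W.symmCapacity ∈ Set.Icc (0 : ℝ) 1 :=
  ⟨symmCapacity_nonneg W, symmCapacity_le_one W⟩

/-- The total variation distance between the output distributions of a channel for the inputs
`0` and `1`. -/
noncomputable def BDMC.totalVariation (W : BDMC Y) : ℝ := ∑ y, |W.prob 0 y - W.prob 1 y| / 2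

theorem gapConst_mul_sq_one_sub_symmCapacity_le (W : BDMC Y) :
    gapConst * (1 - W.symmCapacity) ^ 2 ≤ 1 - W.totalVariation := by
  let m y := (W.prob 0 y + W.prob 1 y) / 2
  have hm : ∀ y, 0 ≤ m y := fun y ↦
    div_nonneg (add_nonneg (W.nonneg _ _) (W.nonneg _ _)) zero_le_two
  have hTV : ∀ y, |W.prob 0 y - W.prob 1 y| / 2 ≤ m y := fun y ↦ by
    refine div_le_div_of_nonneg_right (abs_sub_le_of_nonneg_of_le (W.nonneg 0 y) ?_
      (W.nonneg 1 y) ?_) zero_le_two <;> linarith [W.nonneg 0 y, W.nonneg 1 y]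
  have hCS := Finset.sum_sq_le_sum_mul_sum_of_sq_le_mul Finset.univ
    (r := fun y ↦ m y - letterInfo (W.prob 0 y) (W.prob 1 y)) (f := m)
    (g := fun y ↦ (m y - |W.prob 0 y - W.prob 1 y| / 2) / gapConst) (fun y _ ↦ hm y)
    (fun y _ ↦ div_nonneg (sub_nonneg.2 (hTV y)) gapConst_pos.le) fun y _ ↦ by
      rw [← mul_div_assoc, le_div_iff₀' gapConst_pos]
      exact gapConst_mul_sq_sub_letterInfo_le (W.nonneg _ _) (W.nonneg _ _)
  have hm_sum : ∑ y, m y = 1 := sum_prob_average W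
  rwa [Finset.sum_sub_distrib, hm_sum, one_mul, ← Finset.sum_div, Finset.sum_sub_distrib, hm_sum,
    ← symmCapacity_eq_sum_letterInfo, le_div_iff₀' gapConst_pos] at hCS

/-- Arıkan's check-node combination of two channels: an input `x` is sent through `A` as `x + w`
and through `B` as `w`, where `w` is a uniform bit not revealed to the receiver. -/
noncomputable def BDMC.minus (A : BDMC Y) (B : BDMC Z) : BDMC (Y × Z) where
  prob x o := ∑ w, 1 / 2 * (A.prob (x + w) o.1 * B.prob w o.2)
  nonneg x o := Finset.sum_nonneg fun w _ ↦
    mul_nonneg one_half_pos.le (mul_nonneg (A.nonneg _ _) (B.nonneg _ _))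
  sum_eq_one x := by
    rw [Finset.sum_comm]
    simp [← Finset.mul_sum, Fintype.sum_prod_type, A.sum_eq_one,
      B.sum_eq_one]

/-- Arıkan's variable-node combination of two channels: an input `x` is sent through `A` as `w + x`
and through `B` as `x`, where `w` is a uniform bit revealed to the receiver. -/
noncomputable def BDMC.plus (A : BDMC Y) (B : BDMC Z) : BDMC ((Y × Z) × ZMod 2) where
  prob x o := 1 / 2 * (A.prob (o.2 + x) o.1.1 * B.prob x o.1.2)
  nonneg x o := mul_nonneg one_half_pos.le (mul_nonneg (A.nonneg _ _) (B.nonneg _ _))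
  sum_eq_one x := by
    rw [Fintype.sum_prod_type_right]
    simp [← Finset.mul_sum, Fintype.sum_prod_type, A.sum_eq_one,
      B.sum_eq_one]

theorem symmCapacity_minus_comm (A : BDMC Y) (B : BDMC Z) :
    (A.minus B).symmCapacity = (B.minus A).symmCapacity := by
  refine symmCapacity_eq_of_equiv (Equiv.prodComm Y Z) fun x o ↦ ?_
  simp only [BDMC.minus, Equiv.prodComm_apply, Prod.fst_swap, Prod.snd_swap]
  refine Fintype.sum_equiv (Equiv.addLeft x) _ _ fun w ↦ ?_
  have hx : x + (x + w) = w := by rw [← add_assoc, CharTwo.add_self_eq_zero, zero_add]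
  rw [Equiv.coe_addLeft, hx, mul_comm (A.prob _ _)]

theorem symmCapacity_minus_eq_sum (A : BDMC Y) (B : BDMC Z) :
    (A.minus B).symmCapacity = ∑ y, ∑ z,
      letterInfo (1 / 2 * (A.prob 0 y * B.prob 0 z + A.prob 1 y * B.prob 1 z))
        (1 / 2 * (A.prob 1 y * B.prob 0 z + A.prob 0 y * B.prob 1 z)) := by
  rw [symmCapacity_eq_sum_letterInfo, Fintype.sum_prod_type]
  simp only [BDMC.minus, sum_zmod_two, add_zero, zero_add, CharTwo.add_self_eq_zero, mul_add]

theorem symmCapacity_plus_eq_sum (A : BDMC Y) (B : BDMC Z) :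
    (A.plus B).symmCapacity = ∑ y, ∑ z,
      (letterInfo (1 / 2 * (A.prob 0 y * B.prob 0 z)) (1 / 2 * (A.prob 1 y * B.prob 1 z)) +
        letterInfo (1 / 2 * (A.prob 1 y * B.prob 0 z)) (1 / 2 * (A.prob 0 y * B.prob 1 z))) := by
  rw [symmCapacity_eq_sum_letterInfo, Fintype.sum_prod_type, Fintype.sum_prod_type]
  simp only [BDMC.plus, sum_zmod_two, add_zero, zero_add, CharTwo.add_self_eq_zero]

theorem symmCapacity_minus_add_plus (A : BDMC Y) (B : BDMC Z) :
    (A.minus B).symmCapacity + (A.plus B).symmCapacity = A.symmCapacity + B.symmCapacity := by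
  rw [symmCapacity_minus_eq_sum, symmCapacity_plus_eq_sum]
  simp only [← Finset.sum_add_distrib, letterInfo_check_add_letterInfo_variable]
  simp only [Finset.sum_add_distrib, ← Finset.sum_mul_sum, sum_prob_average,
    ← symmCapacity_eq_sum_letterInfo, mul_one, one_mul]

theorem symmCapacity_minus_le_mul_totalVariation (A : BDMC Y) (B : BDMC Z) :
    (A.minus B).symmCapacity ≤ A.symmCapacity * B.totalVariation := by
  rw [symmCapacity_minus_eq_sum, symmCapacity_eq_sum_letterInfo, BDMC.totalVariation,
    Finset.sum_mul_sum]
  exact Finset.sum_le_sum fun y _ ↦ Finset.sum_le_sum fun z _ ↦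
    letterInfo_check_le (A.nonneg _ _) (A.nonneg _ _) (B.nonneg _ _) (B.nonneg _ _)

theorem symmCapacity_minus_le_left (A : BDMC Y) (B : BDMC Z) :
    (A.minus B).symmCapacity ≤ A.symmCapacity * (1 - gapConst * (1 - B.symmCapacity) ^ 2) :=
  (symmCapacity_minus_le_mul_totalVariation A B).trans <|
    mul_le_mul_of_nonneg_left (by linarith [gapConst_mul_sq_one_sub_symmCapacity_le B])
      (symmCapacity_nonneg A)

theorem symmCapacity_minus_le_right (A : BDMC Y) (B : BDMC Z) :
    (A.minus B).symmCapacity ≤ B.symmCapacity * (1 - gapConst * (1 - A.symmCapacity) ^ 2) :=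
  symmCapacity_minus_comm A B ▸ symmCapacity_minus_le_left B A

end Channel

section Spread

/-- The quantity `x (1 - x)`, which measures how far `x ∈ [0, 1]` is from being polarized, that is
from `{0, 1}`. -/
def spread (x : ℝ) : ℝ := x * (1 - x)

theorem spread_nonneg {x : ℝ} (hx : x ∈ Set.Icc (0 : ℝ) 1) : 0 ≤ spread x :=
  mul_nonneg hx.1 (sub_nonneg.2 hx.2)

theorem spread_add_spread_le {a b s t : ℝ} (hsum : s + t = a + b) (ha : s ≤ a) (hb : s ≤ b) :
    spread s + spread t ≤ spread a + spread b := by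
  obtain rfl : t = a + b - s := by linarith
  unfold spread
  nlinarith [mul_nonneg (sub_nonneg.2 ha) (sub_nonneg.2 hb)]

theorem two_mul_gapConst_mul_spread_sq_le {a b s : ℝ} (ha : a ∈ Set.Icc (0 : ℝ) 1)
    (hsa : s ≤ a * (1 - gapConst * (1 - b) ^ 2))
    (hsb : s ≤ b * (1 - gapConst * (1 - a) ^ 2)) :
    2 * (gapConst * spread a ^ 2) ≤ a + b - 2 * s := by
  obtain ⟨ha0, ha1⟩ := ha
  have hκ0 := gapConst_pos.le
  have hκ := gapConst_le_quarter
  have hspread : gapConst * spread a ^ 2 ≤ gapConst * (a * (1 - a) ^ 2) := by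
    rw [spread, mul_pow]
    gcongr
    nlinarith
  rcases le_total a b with hab | hba
  · have hsq : (1 - a) ^ 2 ≤ (1 - b) ^ 2 + 2 * (b - a) := by nlinarith
    have hweight : gapConst * a ≤ 1 / 4 := by nlinarith
    have hκa : 0 ≤ gapConst * a := mul_nonneg hκ0 ha0
    nlinarith [mul_le_mul_of_nonneg_left hsq hκa, mul_nonneg (sub_nonneg.2 hweight)
      (sub_nonneg.2 hab)]
  · have hweight : gapConst * (1 - a) ^ 2 ≤ 1 / 4 := by nlinarith
    nlinarith [mul_nonneg (sub_nonneg.2 hweight) (sub_nonneg.2 hba)]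

variable {Y Z : Type*} [Fintype Y] [Fintype Z]

theorem symmCapacity_minus_le_min (A : BDMC Y) (B : BDMC Z) :
    (A.minus B).symmCapacity ≤ min A.symmCapacity B.symmCapacity := by
  have hsq : ∀ x, 0 ≤ gapConst * (1 - x) ^ 2 := fun x ↦ mul_nonneg gapConst_pos.le (sq_nonneg _)
  refine le_min ((symmCapacity_minus_le_left A B).trans ?_)
    ((symmCapacity_minus_le_right A B).trans ?_)
  · exact mul_le_of_le_one_right (symmCapacity_nonneg A) (sub_le_self 1 (hsq _))
  · exact mul_le_of_le_one_right (symmCapacity_nonneg B) (sub_le_self 1 (hsq _))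

theorem spread_minus_add_spread_plus_le (A : BDMC Y) (B : BDMC Z) :
    spread (A.minus B).symmCapacity + spread (A.plus B).symmCapacity ≤
      spread A.symmCapacity + spread B.symmCapacity :=
  have hmin := le_min_iff.1 (symmCapacity_minus_le_min A B)
  spread_add_spread_le (symmCapacity_minus_add_plus A B) hmin.1 hmin.2

theorem gapConst_mul_spread_sq_add_le_plus_sub_minus (A : BDMC Y) (B : BDMC Z) :
    gapConst * (spread A.symmCapacity ^ 2 + spread B.symmCapacity ^ 2) ≤
      (A.plus B).symmCapacity - (A.minus B).symmCapacity := by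
  have hA := two_mul_gapConst_mul_spread_sq_le (symmCapacity_mem_Icc A)
    (symmCapacity_minus_le_left A B) (symmCapacity_minus_le_right A B)
  have hB := two_mul_gapConst_mul_spread_sq_le (symmCapacity_mem_Icc B)
    (symmCapacity_minus_le_right A B) (symmCapacity_minus_le_left A B)
  linarith [symmCapacity_minus_add_plus A B]

end Spread

section Index

variable {n : ℕ}

/-- The index obtained from `i` by inserting a new least significant binary digit. -/
def consBit : Fin (2 ^ n) × Fin 2 ≃ Fin (2 ^ (n + 1)) :=
  ((Equiv.prodComm _ _).trans ((Equiv.refl (Fin 2)).prodCongr bits)).trans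
    ((Fin.consEquiv fun _ ↦ Fin 2).trans bits.symm)

/-- The index obtained from `i` by inserting a new most significant binary digit. -/
def snocBit : Fin (2 ^ n) × Fin 2 ≃ Fin (2 ^ (n + 1)) :=
  ((Equiv.prodComm _ _).trans ((Equiv.refl (Fin 2)).prodCongr bits)).trans
    ((Fin.snocEquiv fun _ ↦ Fin 2).trans bits.symm)

theorem bits_consBit (i : Fin (2 ^ n)) (b : Fin 2) :
    bits (consBit (i, b)) = Fin.cons (α := fun _ ↦ Fin 2) b (bits i) := by
  simp [consBit, Fin.consEquiv]

theorem bits_snocBit (j : Fin (2 ^ n)) (b : Fin 2) :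
    bits (snocBit (j, b)) = Fin.snoc (α := fun _ ↦ Fin 2) (bits j) b := by
  simp [snocBit, Fin.snocEquiv]

theorem consBit_val (i : Fin (2 ^ n)) (b : Fin 2) : (consBit (i, b) : ℕ) = 2 * i + b := by
  have hval {m : ℕ} (k : Fin (2 ^ m)) : (k : ℕ) = ∑ l, (bits k l : ℕ) * 2 ^ (l : ℕ) := by
    rw [← finFunctionFinEquiv_apply, bits, Equiv.apply_symm_apply]
  rw [hval, Fin.sum_univ_succ, hval i, Finset.mul_sum, bits_consBit]
  simp only [Fin.cons_zero, Fin.cons_succ, Fin.val_zero, Fin.val_succ, pow_zero, pow_succ']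
  rw [mul_one, add_comm]
  simp only [mul_left_comm]

theorem consBit_lt_consBit_zero {i j : Fin (2 ^ n)} {b : Fin 2} :
    consBit (j, b) < consBit (i, 0) ↔ j < i := by
  simp only [Fin.lt_def, consBit_val, Fin.val_zero]
  omega

theorem lt_consBit_one {i : Fin (2 ^ n)} {k : Fin (2 ^ (n + 1))} :
    k < consBit (i, 1) ↔ k ≤ consBit (i, 0) := by
  simp only [Fin.lt_def, Fin.le_def, consBit_val, Fin.val_zero, Fin.val_one]
  omega

theorem sum_consBit {M : Type*} [AddCommMonoid M] (f : Fin (2 ^ (n + 1)) → M) :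
    ∑ k, f k = ∑ i, (f (consBit (i, 0)) + f (consBit (i, 1))) := by
  rw [← consBit.sum_comp, Fintype.sum_prod_type]
  simp only [Fin.sum_univ_two]

theorem prod_snocBit {M : Type*} [CommMonoid M] (f : Fin (2 ^ (n + 1)) → M) :
    ∏ k, f k = (∏ j, f (snocBit (j, 0))) * ∏ j, f (snocBit (j, 1)) := by
  rw [← snocBit.prod_comp, Fintype.prod_prod_type_right, Fin.prod_univ_two]

theorem polarMatrix_apply (i j : Fin (2 ^ n)) :
    polarMatrix n i j = ∏ k, kernelF (bits i k.rev) (bits j k) := by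
  simp [polarMatrix, Equiv.Perm.permMatrix, PEquiv.toMatrix_toPEquiv_mul, kroneckerPowF,
    bitReversal, Equiv.arrowCongr]

theorem polarMatrix_consBit_snocBit (i j : Fin (2 ^ n)) (a b : Fin 2) :
    polarMatrix (n + 1) (consBit (i, a)) (snocBit (j, b)) = polarMatrix n i j * kernelF a b := by
  simp [polarMatrix_apply, Fin.prod_univ_castSucc, bits_consBit, bits_snocBit, Fin.rev_castSucc]

/-- A dependent function on `ι × Fin 2`, encoded by its restrictions to `ι × {0}` and `ι × {1}`. -/
def piProdFinTwoEquiv {ι : Type*} (Z : ι × Fin 2 → Type*) :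
    (∀ k, Z k) ≃ (∀ i, Z (i, 0)) × (∀ i, Z (i, 1)) where
  toFun z := (fun i ↦ z (i, 0), fun i ↦ z (i, 1))
  invFun p
    | (i, 0) => p.1 i
    | (i, 1) => p.2 i
  left_inv z := by
    funext ⟨i, b⟩
    fin_cases b <;> rfl
  right_inv _ := rfl

/-- The kernel `F` acting on a family of pairs of bits. -/
def kernelEquiv (ι : Type*) : (ι × Fin 2 → ZMod 2) ≃ (ι → ZMod 2) × (ι → ZMod 2) where
  toFun u := (fun i ↦ u (i, 0) + u (i, 1), fun i ↦ u (i, 1))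
  invFun p k := ![p.1 k.1 - p.2 k.1, p.2 k.1] k.2
  left_inv u := by
    funext ⟨i, b⟩
    fin_cases b <;> simp
  right_inv p := by simp

/-- The first layer of the polar transform: it turns an input `u` of `2 ^ (n + 1)` channels into
the inputs of the two blocks of `2 ^ n` channels. -/
def inputEquiv (n : ℕ) : (Fin (2 ^ (n + 1)) → ZMod 2) ≃
    (Fin (2 ^ n) → ZMod 2) × (Fin (2 ^ n) → ZMod 2) :=
  (consBit.symm.arrowCongr (Equiv.refl _)).trans (kernelEquiv _)

theorem vecMul_polarMatrix_snocBit_zero (u : Fin (2 ^ (n + 1)) → ZMod 2) (j : Fin (2 ^ n)) :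
    (u ᵥ* polarMatrix (n + 1)) (snocBit (j, 0)) = ((inputEquiv n u).1 ᵥ* polarMatrix n) j := by
  simp [Matrix.vecMul, dotProduct, sum_consBit, polarMatrix_consBit_snocBit, kernelF, inputEquiv,
    kernelEquiv, add_mul]

theorem vecMul_polarMatrix_snocBit_one (u : Fin (2 ^ (n + 1)) → ZMod 2) (j : Fin (2 ^ n)) :
    (u ᵥ* polarMatrix (n + 1)) (snocBit (j, 1)) = ((inputEquiv n u).2 ᵥ* polarMatrix n) j := by
  simp [Matrix.vecMul, dotProduct, sum_consBit, polarMatrix_consBit_snocBit, kernelF, inputEquiv,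
    kernelEquiv]

/-- The first layer of the polar transform on the input bits that precede the index
`consBit (i, 0)`. -/
def prefixEquiv (i : Fin (2 ^ n)) : ({k // k < consBit (i, 0)} → ZMod 2) ≃
    ({j // j < i} → ZMod 2) × ({j // j < i} → ZMod 2) :=
  ((((Equiv.prodSubtypeFstEquivSubtypeProd (p := (· < i))).symm.trans
    (consBit.subtypeEquiv fun _ ↦ consBit_lt_consBit_zero.symm)).symm).arrowCongr
      (Equiv.refl _)).trans (kernelEquiv _)

/-- The input bits that precede the index `consBit (i, 1)` are those that precede
`consBit (i, 0)` and the one at `consBit (i, 0)`. -/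
def prefixSuccEquiv (i : Fin (2 ^ n)) : ({k // k < consBit (i, 1)} → ZMod 2) ≃
    ({k // k < consBit (i, 0)} → ZMod 2) × ZMod 2 where
  toFun v := (fun k ↦ v ⟨k, lt_consBit_one.2 k.2.le⟩, v ⟨consBit (i, 0), lt_consBit_one.2 le_rfl⟩)
  invFun p k := if h : k < consBit (i, 0) then p.1 ⟨k, h⟩ else p.2
  left_inv v := by
    funext ⟨k, hk⟩
    rcases (lt_consBit_one.1 hk).lt_or_eq with h | rfl
    · simp [h]
    · simp
  right_inv _ := Prod.ext (funext fun k ↦ dif_pos k.2) (dif_neg (lt_irrefl _))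

end Index

section Recursion

variable {n : ℕ} {Y : Fin (2 ^ (n + 1)) → Type*}

/-- The output alphabets of a family of channels, grouped by the most significant digit of the
index. -/
def blockOutputEquiv (Y : Fin (2 ^ (n + 1)) → Type*) :
    (∀ k, Y k) ≃ (∀ j, Y (snocBit (j, 0))) × (∀ j, Y (snocBit (j, 1))) :=
  (Equiv.piCongrLeft Y snocBit).symm.trans (piProdFinTwoEquiv _)

/-- The outputs of the synthesized channel with index `consBit (i, 0)` as pairs of outputs of the
synthesized channels with index `i` of the two blocks. -/
def outputEquivZero (Y : Fin (2 ^ (n + 1)) → Type*) (i : Fin (2 ^ n)) :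
    (∀ k, Y k) × ({k // k < consBit (i, 0)} → ZMod 2) ≃
      ((∀ j, Y (snocBit (j, 0))) × ({j // j < i} → ZMod 2)) ×
        ((∀ j, Y (snocBit (j, 1))) × ({j // j < i} → ZMod 2)) :=
  ((blockOutputEquiv Y).prodCongr (prefixEquiv i)).trans (Equiv.prodProdProdComm _ _ _ _)

/-- The outputs of the synthesized channel with index `consBit (i, 1)`: the input bit at
`consBit (i, 0)` is revealed as well. -/
def outputEquivOne (Y : Fin (2 ^ (n + 1)) → Type*) (i : Fin (2 ^ n)) :
    (∀ k, Y k) × ({k // k < consBit (i, 1)} → ZMod 2) ≃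
      (((∀ j, Y (snocBit (j, 0))) × ({j // j < i} → ZMod 2)) ×
        ((∀ j, Y (snocBit (j, 1))) × ({j // j < i} → ZMod 2))) × ZMod 2 :=
  (((Equiv.refl _).prodCongr (prefixSuccEquiv i)).trans (Equiv.prodAssoc _ _ _).symm).trans
    ((outputEquivZero Y i).prodCongr (Equiv.refl _))

variable [∀ k, Fintype (Y k)]

/-- The block of `2 ^ n` channels whose index has most significant digit `b`. -/
def block (W : (k : Fin (2 ^ (n + 1))) → BDMC (Y k)) (b : Fin 2) (j : Fin (2 ^ n)) :
    BDMC (Y (snocBit (j, b))) :=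
  W (snocBit (j, b))

theorem combined_eq_mul_combined_block (W : (k : Fin (2 ^ (n + 1))) → BDMC (Y k))
    (u : Fin (2 ^ (n + 1)) → ZMod 2) (y : (k : Fin (2 ^ (n + 1))) → Y k) :
    combined W u y = combined (block W 0) (inputEquiv n u).1 (blockOutputEquiv Y y).1 *
      combined (block W 1) (inputEquiv n u).2 (blockOutputEquiv Y y).2 := by
  unfold combined
  rw [prod_snocBit]
  simp only [vecMul_polarMatrix_snocBit_zero, vecMul_polarMatrix_snocBit_one]
  rfl

theorem splitProb_block_mul_splitProb_block (W : (k : Fin (2 ^ (n + 1))) → BDMC (Y k))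
    (i : Fin (2 ^ n)) (s t : ZMod 2)
    (o : (∀ k, Y k) × ({k // k < consBit (i, 0)} → ZMod 2)) :
    1 / 2 * (splitProb (block W 0) i s (outputEquivZero Y i o).1 *
      splitProb (block W 1) i t (outputEquivZero Y i o).2) =
    ∑ u : Fin (2 ^ (n + 1)) → ZMod 2 with
      (u (consBit (i, 0)) + u (consBit (i, 1)) = s ∧ u (consBit (i, 1)) = t) ∧
        (fun k : {k // k < consBit (i, 0)} ↦ u k) = o.2,
      1 / 2 ^ (2 ^ (n + 1) - 1) * combined W u o.1 := by
  have hexp : (2 : ℝ) ^ (2 ^ (n + 1) - 1) = 2 * (2 ^ (2 ^ n - 1) * 2 ^ (2 ^ n - 1)) := by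
    have : 0 < 2 ^ n := by positivity
    rw [← pow_add, ← pow_succ']
    congr 1
    omega
  unfold splitProb
  rw [Finset.sum_mul_sum, ← Finset.sum_product', Finset.mul_sum]
  refine (Finset.sum_equiv (inputEquiv n) (fun u ↦ ?_) fun u _ ↦ ?_).symm
  · have hprefix : (fun k : {k // k < consBit (i, 0)} ↦ u k) = o.2 ↔
        (fun j : {j // j < i} ↦ (inputEquiv n u).1 j) = (outputEquivZero Y i o).1.2 ∧
          (fun j : {j // j < i} ↦ (inputEquiv n u).2 j) = (outputEquivZero Y i o).2.2 := by
      rw [← (prefixEquiv i).apply_eq_iff_eq, Prod.ext_iff]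
      rfl
    simp only [Finset.mem_filter, Finset.mem_univ, true_and, Finset.mem_product, hprefix]
    exact and_and_and_comm
  · rw [combined_eq_mul_combined_block, hexp]
    change _ = 1 / 2 * (1 / 2 ^ (2 ^ n - 1) *
      combined (block W 0) (inputEquiv n u).1 (blockOutputEquiv Y o.1).1 *
        (1 / 2 ^ (2 ^ n - 1) *
          combined (block W 1) (inputEquiv n u).2 (blockOutputEquiv Y o.1).2))
    field_simp

theorem prob_synthesized_consBit_zero (W : (k : Fin (2 ^ (n + 1))) → BDMC (Y k)) (i : Fin (2 ^ n))
    (x : ZMod 2) (o : (∀ k, Y k) × ({k // k < consBit (i, 0)} → ZMod 2)) :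
    (synthesized W (consBit (i, 0))).prob x o =
      ((synthesized (block W 0) i).minus (synthesized (block W 1) i)).prob x
        (outputEquivZero Y i o) := by
  simp only [synthesized, BDMC.minus, splitProb_block_mul_splitProb_block]
  unfold splitProb
  rw [← Finset.sum_fiberwise _ fun u ↦ u (consBit (i, 1))]
  refine Finset.sum_congr rfl fun w _ ↦ ?_
  rw [Finset.filter_filter]
  refine Finset.sum_congr (Finset.filter_congr fun u _ ↦ ?_) fun _ _ ↦ rfl
  constructor
  · rintro ⟨⟨rfl, h⟩, rfl⟩
    exact ⟨⟨rfl, rfl⟩, h⟩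
  · rintro ⟨⟨h, rfl⟩, h'⟩
    exact ⟨⟨add_right_cancel h, h'⟩, rfl⟩

theorem prob_synthesized_consBit_one (W : (k : Fin (2 ^ (n + 1))) → BDMC (Y k)) (i : Fin (2 ^ n))
    (x : ZMod 2) (o : (∀ k, Y k) × ({k // k < consBit (i, 1)} → ZMod 2)) :
    (synthesized W (consBit (i, 1))).prob x o =
      ((synthesized (block W 0) i).plus (synthesized (block W 1) i)).prob x
        (outputEquivOne Y i o) := by
  have hprefix (u : Fin (2 ^ (n + 1)) → ZMod 2) :
      (fun k : {k // k < consBit (i, 1)} ↦ u k) = o.2 ↔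
        (fun k : {k // k < consBit (i, 0)} ↦ u k) = (prefixSuccEquiv i o.2).1 ∧
          u (consBit (i, 0)) = (prefixSuccEquiv i o.2).2 := by
    rw [← (prefixSuccEquiv i).apply_eq_iff_eq, Prod.ext_iff]
    rfl
  refine Eq.trans ?_ (splitProb_block_mul_splitProb_block W i ((prefixSuccEquiv i o.2).2 + x) x
    (o.1, (prefixSuccEquiv i o.2).1)).symm
  refine Finset.sum_congr (Finset.filter_congr fun u _ ↦ ?_) fun _ _ ↦ rfl
  rw [hprefix]
  constructor
  · rintro ⟨rfl, h, h'⟩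
    exact ⟨⟨by rw [h'], rfl⟩, h⟩
  · rintro ⟨⟨h, rfl⟩, h'⟩
    exact ⟨rfl, h', add_right_cancel h⟩

theorem symmCapacity_synthesized_consBit_zero (W : (k : Fin (2 ^ (n + 1))) → BDMC (Y k))
    (i : Fin (2 ^ n)) :
    (synthesized W (consBit (i, 0))).symmCapacity =
      ((synthesized (block W 0) i).minus (synthesized (block W 1) i)).symmCapacity :=
  symmCapacity_eq_of_equiv (outputEquivZero Y i) (prob_synthesized_consBit_zero W i)

theorem symmCapacity_synthesized_consBit_one (W : (k : Fin (2 ^ (n + 1))) → BDMC (Y k))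
    (i : Fin (2 ^ n)) :
    (synthesized W (consBit (i, 1))).symmCapacity =
      ((synthesized (block W 0) i).plus (synthesized (block W 1) i)).symmCapacity :=
  symmCapacity_eq_of_equiv (outputEquivOne Y i) (prob_synthesized_consBit_one W i)

end Recursion

section Polarization

variable {n : ℕ}

theorem symmCapacity_synthesized_zero {Y : Fin (2 ^ 0) → Type*} [∀ i, Fintype (Y i)]
    (W : (i : Fin (2 ^ 0)) → BDMC (Y i)) (i : Fin (2 ^ 0)) :
    (synthesized W i).symmCapacity = (W i).symmCapacity := by
  let _ : Unique (Fin (2 ^ 0)) := inferInstanceAs (Unique (Fin 1))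
  obtain rfl := Unique.eq_default i
  have : IsEmpty {j : Fin (2 ^ 0) // j < default} := ⟨fun j ↦ j.2.ne (Subsingleton.elim _ _)⟩
  refine symmCapacity_eq_of_equiv ((Equiv.prodUnique _ _).trans (Equiv.piUnique Y)) fun x o ↦ ?_
  have hmatrix (i j : Fin (2 ^ 0)) : polarMatrix 0 i j = 1 := by simp [polarMatrix_apply]
  have hfilter : ({u : Fin (2 ^ 0) → ZMod 2 | u default = x ∧
      (fun j : {j // j < default} ↦ u j) = o.2} : Finset _) = {fun _ ↦ x} := by
    ext u
    simp [funext_iff, Unique.forall_iff, Subsingleton.elim _ o.2]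
  simp only [synthesized, splitProb, hfilter, Finset.sum_singleton, combined]
  simp [Matrix.vecMul, dotProduct, hmatrix]

theorem sum_block {Y : Fin (2 ^ (n + 1)) → Type*} [∀ k, Fintype (Y k)]
    (W : (k : Fin (2 ^ (n + 1))) → BDMC (Y k)) :
    ∑ k, (W k).symmCapacity =
      ∑ j, (block W 0 j).symmCapacity + ∑ j, (block W 1 j).symmCapacity := by
  rw [← snocBit.sum_comp, Fintype.sum_prod_type_right, Fin.sum_univ_two]
  rfl

theorem sum_symmCapacity_synthesized : ∀ {n : ℕ} {Y : Fin (2 ^ n) → Type*} [∀ i, Fintype (Y i)]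
    (W : (i : Fin (2 ^ n)) → BDMC (Y i)),
    ∑ i, (synthesized W i).symmCapacity = ∑ i, (W i).symmCapacity
  | 0, _, _, W => Finset.sum_congr rfl fun i _ ↦ symmCapacity_synthesized_zero W i
  | n + 1, _, _, W => by
    rw [sum_consBit, sum_block, ← sum_symmCapacity_synthesized (block W 0),
      ← sum_symmCapacity_synthesized (block W 1), ← Finset.sum_add_distrib]
    refine Finset.sum_congr rfl fun i _ ↦ ?_
    rw [symmCapacity_synthesized_consBit_zero, symmCapacity_synthesized_consBit_one,
      symmCapacity_minus_add_plus]

/-- The number of binary digits `1` of `i` minus the number of digits `0`, that is, the number of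
`plus` steps minus the number of `minus` steps in the construction of the `i`-th synthesized
channel. -/
def bias (i : Fin (2 ^ n)) : ℝ := ∑ k, ![-1, 1] (bits i k)

theorem bias_consBit (i : Fin (2 ^ n)) (b : Fin 2) :
    bias (consBit (i, b)) = ![-1, 1] b + bias i := by
  simp [bias, bits_consBit, Fin.sum_univ_succ]

theorem sum_bias_sq (n : ℕ) : ∑ i : Fin (2 ^ n), bias i ^ 2 = n * 2 ^ n := by
  induction n with
  | zero => simp [bias]
  | succ n ih =>
    have hpair (i : Fin (2 ^ n)) :
        bias (consBit (i, 0)) ^ 2 + bias (consBit (i, 1)) ^ 2 = 2 * bias i ^ 2 + 2 := by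
      simp only [bias_consBit, Matrix.cons_val_zero, Matrix.cons_val_one]
      ring
    simp only [sum_consBit, hpair, Finset.sum_add_distrib, ← Finset.mul_sum, ih]
    simp
    ring

section Step

variable {Y : Fin (2 ^ (n + 1)) → Type*} [∀ k, Fintype (Y k)]
  (W : (k : Fin (2 ^ (n + 1))) → BDMC (Y k))

theorem sum_spread_synthesized_le :
    ∑ k, spread (synthesized W k).symmCapacity ≤
      ∑ i, spread (synthesized (block W 0) i).symmCapacity +
        ∑ i, spread (synthesized (block W 1) i).symmCapacity := by
  rw [sum_consBit, ← Finset.sum_add_distrib]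
  refine Finset.sum_le_sum fun i _ ↦ ?_
  rw [symmCapacity_synthesized_consBit_zero, symmCapacity_synthesized_consBit_one]
  exact spread_minus_add_spread_plus_le _ _

theorem sum_bias_mul_symmCapacity_synthesized :
    ∑ k, bias k * (synthesized W k).symmCapacity =
      ∑ i, bias i * (synthesized (block W 0) i).symmCapacity +
        ∑ i, bias i * (synthesized (block W 1) i).symmCapacity +
          ∑ i, (((synthesized (block W 0) i).plus (synthesized (block W 1) i)).symmCapacity -
            ((synthesized (block W 0) i).minus (synthesized (block W 1) i)).symmCapacity) := by
  rw [sum_consBit, ← Finset.sum_add_distrib, ← Finset.sum_add_distrib]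
  refine Finset.sum_congr rfl fun i _ ↦ ?_
  rw [symmCapacity_synthesized_consBit_zero, symmCapacity_synthesized_consBit_one, ← mul_add,
    ← symmCapacity_minus_add_plus, bias_consBit, bias_consBit, Matrix.cons_val_zero,
    Matrix.cons_val_one, Matrix.cons_val_zero]
  ring

theorem gapConst_mul_sq_sum_spread_add_le :
    gapConst * ((∑ i, spread (synthesized (block W 0) i).symmCapacity) ^ 2 +
        (∑ i, spread (synthesized (block W 1) i).symmCapacity) ^ 2) ≤
      2 ^ n *
        ∑ i, (((synthesized (block W 0) i).plus (synthesized (block W 1) i)).symmCapacity -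
          ((synthesized (block W 0) i).minus (synthesized (block W 1) i)).symmCapacity) := by
  have hCS (f : Fin (2 ^ n) → ℝ) : (∑ i, f i) ^ 2 ≤ 2 ^ n * ∑ i, f i ^ 2 := by
    simpa using sq_sum_le_card_mul_sum_sq (s := Finset.univ) (f := f)
  calc _ ≤ gapConst * (2 ^ n * ∑ i, spread (synthesized (block W 0) i).symmCapacity ^ 2 +
        2 ^ n * ∑ i, spread (synthesized (block W 1) i).symmCapacity ^ 2) :=
        mul_le_mul_of_nonneg_left (add_le_add (hCS _) (hCS _)) gapConst_pos.le
    _ = 2 ^ n * ∑ i, gapConst * (spread (synthesized (block W 0) i).symmCapacity ^ 2 +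
        spread (synthesized (block W 1) i).symmCapacity ^ 2) := by
        rw [← Finset.mul_sum, Finset.sum_add_distrib]
        ring
    _ ≤ _ := by
        gcongr
        exact gapConst_mul_spread_sq_add_le_plus_sub_minus _ _

end Step

theorem sum_spread_synthesized_nonneg {Y : Fin (2 ^ n) → Type*} [∀ i, Fintype (Y i)]
    (W : (i : Fin (2 ^ n)) → BDMC (Y i)) : 0 ≤ ∑ i, spread (synthesized W i).symmCapacity :=
  Finset.sum_nonneg fun _ _ ↦ spread_nonneg (symmCapacity_mem_Icc _)

theorem gapConst_mul_sq_sum_spread_synthesized_le : ∀ {n : ℕ} {Y : Fin (2 ^ n) → Type*}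
    [∀ i, Fintype (Y i)] (W : (i : Fin (2 ^ n)) → BDMC (Y i)),
    n * (gapConst * (∑ i, spread (synthesized W i).symmCapacity) ^ 2) ≤
      2 ^ n * ∑ i, bias i * (synthesized W i).symmCapacity
  | 0, _, _, W => by simp [bias]
  | n + 1, _, _, W => by
    have ih0 := gapConst_mul_sq_sum_spread_synthesized_le (block W 0)
    have ih1 := gapConst_mul_sq_sum_spread_synthesized_le (block W 1)
    have hstep := gapConst_mul_sq_sum_spread_add_le W
    have hspread := sum_spread_synthesized_le W
    have hnonneg := sum_spread_synthesized_nonneg W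
    rw [sum_bias_mul_symmCapacity_synthesized W]
    set S := ∑ k, spread (synthesized W k).symmCapacity
    set S₀ := ∑ i, spread (synthesized (block W 0) i).symmCapacity
    set S₁ := ∑ i, spread (synthesized (block W 1) i).symmCapacity
    have hκ := gapConst_pos.le
    have hsq : S ^ 2 ≤ 2 * (S₀ ^ 2 + S₁ ^ 2) :=
      (pow_le_pow_left₀ hnonneg hspread 2).trans add_sq_le
    calc ((n + 1 : ℕ) : ℝ) * (gapConst * S ^ 2)
        ≤ (n + 1 : ℕ) * (gapConst * (2 * (S₀ ^ 2 + S₁ ^ 2))) := by gcongr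
      _ = 2 * (n * (gapConst * S₀ ^ 2) + n * (gapConst * S₁ ^ 2) +
            gapConst * (S₀ ^ 2 + S₁ ^ 2)) := by push_cast; ring
      _ ≤ _ := by rw [pow_succ' (2 : ℝ) n]; linarith

variable {Y : Fin (2 ^ n) → Type*} [∀ i, Fintype (Y i)]

theorem sq_sum_bias_mul_symmCapacity_le (W : (i : Fin (2 ^ n)) → BDMC (Y i)) :
    (∑ i, bias i * (synthesized W i).symmCapacity) ^ 2 ≤ n * (2 ^ n) ^ 2 := by
  have hcap : ∑ i, (synthesized W i).symmCapacity ^ 2 ≤ 2 ^ n := by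
    simpa using Finset.sum_le_card_nsmul Finset.univ _ 1 fun i _ ↦
      pow_le_one₀ (symmCapacity_nonneg (synthesized W i)) (symmCapacity_le_one _)
  calc _ ≤ (∑ i : Fin (2 ^ n), bias i ^ 2) * ∑ i, (synthesized W i).symmCapacity ^ 2 :=
        Finset.sum_mul_sq_le_sq_mul_sq _ _ _
    _ ≤ n * 2 ^ n * 2 ^ n := by rw [sum_bias_sq]; gcongr
    _ = n * (2 ^ n) ^ 2 := by ring

theorem nat_mul_average_spread_synthesized_le_one (W : (i : Fin (2 ^ n)) → BDMC (Y i)) :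
    n * (gapConst * ((∑ i, spread (synthesized W i).symmCapacity) / 2 ^ n) ^ 2) ^ 2 ≤ 1 := by
  rcases n.eq_zero_or_pos with rfl | hn
  · simp
  set S := ∑ i, spread (synthesized W i).symmCapacity
  have hκ := gapConst_pos.le
  have hsq : (n * (gapConst * S ^ 2)) ^ 2 ≤ (2 ^ n) ^ 2 * (n * (2 ^ n) ^ 2) :=
    calc _ ≤ (2 ^ n * ∑ i, bias i * (synthesized W i).symmCapacity) ^ 2 :=
          pow_le_pow_left₀ (by positivity) (gapConst_mul_sq_sum_spread_synthesized_le W) 2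
      _ ≤ _ := by
          rw [mul_pow]
          gcongr
          exact sq_sum_bias_mul_symmCapacity_le W
  set N : ℝ := 2 ^ n
  have hN : 0 < N := by positivity
  refine le_of_mul_le_mul_left ?_ (by positivity : 0 < n * N ^ 4)
  calc n * N ^ 4 * (n * (gapConst * (S / N) ^ 2) ^ 2)
      = (n * (gapConst * S ^ 2)) ^ 2 := by field_simp
    _ ≤ N ^ 2 * (n * N ^ 2) := hsq
    _ = n * N ^ 4 * 1 := by ring

end Polarization

section Limit

open Filter Topology Set

theorem tendsto_zero_of_pow {α 𝕜 : Type*} [NormedDivisionRing 𝕜] {l : Filter α} {f : α → 𝕜}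
    {k : ℕ} (hk : k ≠ 0) (hf : Tendsto (fun a ↦ f a ^ k) l (𝓝 0)) : Tendsto f l (𝓝 0) :=
  (Asymptotics.isLittleO_one_iff 𝕜).1 <|
    .of_pow (by simpa [Pi.pow_def] using (Asymptotics.isLittleO_one_iff 𝕜).2 hf) hk

theorem tendsto_average_spread_synthesized {Y : (n : ℕ) → Fin (2 ^ n) → Type*}
    [∀ n i, Fintype (Y n i)] (W : (n : ℕ) → (i : Fin (2 ^ n)) → BDMC (Y n i)) :
    Tendsto (fun n ↦ (∑ i, spread (synthesized (W n) i).symmCapacity) / 2 ^ n) atTop (𝓝 0) := by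
  have hpow : Tendsto (fun n ↦
      (gapConst * ((∑ i, spread (synthesized (W n) i).symmCapacity) / 2 ^ n) ^ 2) ^ 2)
      atTop (𝓝 0) := by
    refine squeeze_zero' (.of_forall fun n ↦ sq_nonneg _) ?_
      (tendsto_const_div_atTop_nhds_zero_nat (1 : ℝ))
    filter_upwards [eventually_gt_atTop 0] with n hn
    rw [le_div_iff₀' (Nat.cast_pos.2 hn)]
    exact nat_mul_average_spread_synthesized_le_one (W n)
  have hsq := (tendsto_zero_of_pow two_ne_zero hpow).const_mul gapConst⁻¹
  simp only [mul_zero, inv_mul_cancel_left₀ gapConst_pos.ne'] at hsq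
  exact tendsto_zero_of_pow two_ne_zero hsq

theorem exists_abs_le_add_mul_spread {r : ℝ → ℝ} {M : ℝ} (hM : ∀ x ∈ Icc (0 : ℝ) 1, |r x| ≤ M)
    (h0 : Tendsto r (𝓝[Icc 0 1] 0) (𝓝 0)) (h1 : Tendsto r (𝓝[Icc 0 1] 1) (𝓝 0))
    {ε : ℝ} (hε : 0 < ε) :
    ∃ C, ∀ x ∈ Icc (0 : ℝ) 1, |r x| ≤ ε + C * spread x := by
  obtain ⟨d₀, hd₀, hr₀⟩ := Metric.tendsto_nhdsWithin_nhds.1 h0 ε hε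
  obtain ⟨d₁, hd₁, hr₁⟩ := Metric.tendsto_nhdsWithin_nhds.1 h1 ε hε
  have hM0 : 0 ≤ M := (abs_nonneg _).trans (hM 0 (left_mem_Icc.2 zero_le_one))
  simp only [Real.dist_eq, sub_zero] at hr₀ hr₁
  refine ⟨M / (d₀ * d₁), fun x hx ↦ ?_⟩
  have hCs : 0 ≤ M / (d₀ * d₁) * spread x := mul_nonneg (by positivity) (spread_nonneg hx)
  rcases lt_or_ge x d₀ with hx0 | hx0
  · linarith [hr₀ hx (by rwa [abs_of_nonneg hx.1])]
  rcases lt_or_ge (1 - x) d₁ with hx1 | hx1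
  · linarith [hr₁ hx (by rwa [abs_sub_comm, abs_of_nonneg (sub_nonneg.2 hx.2)])]
  have hd : d₀ * d₁ ≤ spread x := mul_le_mul hx0 hx1 hd₁.le hx.1
  calc |r x| ≤ M := hM x hx
    _ = M / (d₀ * d₁) * (d₀ * d₁) := by field_simp
    _ ≤ M / (d₀ * d₁) * spread x := by gcongr
    _ ≤ ε + M / (d₀ * d₁) * spread x := by linarith

theorem tendsto_average_synthesized_zero {Y : (n : ℕ) → Fin (2 ^ n) → Type*}
    [∀ n i, Fintype (Y n i)] (W : (n : ℕ) → (i : Fin (2 ^ n)) → BDMC (Y n i))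
    {r : ℝ → ℝ} {M : ℝ} (hM : ∀ x ∈ Icc (0 : ℝ) 1, |r x| ≤ M)
    (h0 : Tendsto r (𝓝[Icc 0 1] 0) (𝓝 0)) (h1 : Tendsto r (𝓝[Icc 0 1] 1) (𝓝 0)) :
    Tendsto (fun n ↦ (∑ i, r (synthesized (W n) i).symmCapacity) / 2 ^ n) atTop (𝓝 0) := by
  refine Metric.tendsto_nhds.2 fun ε hε ↦ ?_
  obtain ⟨C, hC⟩ := exists_abs_le_add_mul_spread hM h0 h1 (half_pos hε)
  have hspread : ∀ᶠ n in atTop,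
      C * ((∑ i, spread (synthesized (W n) i).symmCapacity) / 2 ^ n) < ε / 2 :=
    ((tendsto_average_spread_synthesized W).const_mul C).eventually_lt_const (by simpa using hε)
  filter_upwards [hspread] with n hn
  rw [Real.dist_eq, sub_zero, abs_div, abs_of_pos (by positivity : (0 : ℝ) < 2 ^ n)]
  calc |∑ i, r (synthesized (W n) i).symmCapacity| / 2 ^ n
      ≤ (∑ i, (ε / 2 + C * spread (synthesized (W n) i).symmCapacity)) / 2 ^ n := by
        gcongr
        exact (Finset.abs_sum_le_sum_abs _ _).trans
          (Finset.sum_le_sum fun i _ ↦ hC _ (symmCapacity_mem_Icc _))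
    _ = ε / 2 + C * ((∑ i, spread (synthesized (W n) i).symmCapacity) / 2 ^ n) := by
        rw [Finset.sum_add_distrib, ← Finset.mul_sum, add_div, mul_div_assoc]
        simp
    _ < ε := by linarith

section Average

variable {n : ℕ} {Y : Fin (2 ^ n) → Type*} [∀ i, Fintype (Y i)]
  (W : (i : Fin (2 ^ n)) → BDMC (Y i))

theorem averageCapacity_eq_average_synthesized :
    averageCapacity W = (∑ i, (synthesized W i).symmCapacity) / 2 ^ n := by
  rw [averageCapacity, sum_symmCapacity_synthesized]

theorem fractionIn_eq_average_indicator (S : Set ℝ) :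
    fractionIn W S = (∑ i, S.indicator 1 (synthesized W i).symmCapacity) / 2 ^ n := by
  classical
  simp only [fractionIn, indicator_apply, Pi.one_apply, Finset.sum_boole,
    ncard_eq_toFinset_card', toFinset_ofPred]

end Average

theorem continuousWithinAt_indicator_of_mem {X R : Type*} [TopologicalSpace X]
    [TopologicalSpace R] [Zero R] {f : X → R} {S T : Set X} {a : X} (ha : a ∈ T)
    (hS : S ∈ 𝓝[T] a) (hf : ContinuousWithinAt f T a) :
    ContinuousWithinAt (S.indicator f) T a :=
  hf.congr_of_eventuallyEq (mem_of_superset hS fun _ hx ↦ indicator_of_mem hx _)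
    (indicator_of_mem (mem_of_mem_nhdsWithin ha hS) _)

theorem continuousWithinAt_indicator_of_compl_mem {X R : Type*} [TopologicalSpace X]
    [TopologicalSpace R] [Zero R] (f : X → R) {S T : Set X} {a : X} (ha : a ∈ T)
    (hS : Sᶜ ∈ 𝓝[T] a) : ContinuousWithinAt (S.indicator f) T a :=
  continuousWithinAt_const.congr_of_eventuallyEq
    (mem_of_superset hS fun _ hx ↦ indicator_of_notMem hx _)
    (indicator_of_notMem (mem_of_mem_nhdsWithin ha hS) _)

theorem mainTheorem1_general {Y : (n : ℕ) → Fin (2 ^ n) → Type*}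
    [∀ n i, Fintype (Y n i)] (W : (n : ℕ) → (i : Fin (2 ^ n)) → BDMC (Y n i))
    {g : ℝ → ℝ} {M : ℝ} (hM : ∀ x ∈ Icc (0 : ℝ) 1, |g x| ≤ M)
    (h0 : ContinuousWithinAt g (Icc 0 1) 0) (h1 : ContinuousWithinAt g (Icc 0 1) 1) :
    Tendsto (fun n ↦ (∑ i, g (synthesized (W n) i).symmCapacity) / 2 ^ n -
      (averageCapacity (W n) * g 1 + (1 - averageCapacity (W n)) * g 0)) atTop (𝓝 0) := by
  have hbound (x : ℝ) (hx : x ∈ Icc (0 : ℝ) 1) :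
      |g x - (x * g 1 + (1 - x) * g 0)| ≤ M + M := by
    have hg0 := abs_le.1 (hM 0 (left_mem_Icc.2 zero_le_one))
    have hg1 := abs_le.1 (hM 1 (right_mem_Icc.2 zero_le_one))
    have hcomb : x * g 1 + (1 - x) * g 0 ∈ Icc (-M) M :=
      convex_Icc (-M) M hg1 hg0 hx.1 (sub_nonneg.2 hx.2) (by ring)
    exact (abs_sub _ _).trans (add_le_add (hM x hx) (abs_le.2 hcomb))
  have hlin : Continuous fun x ↦ x * g 1 + (1 - x) * g 0 := by fun_prop
  refine (tendsto_average_synthesized_zero W hbound ?_ ?_).congr fun n ↦ ?_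
  · simpa [Pi.sub_def] using (h0.sub hlin.continuousWithinAt).tendsto
  · simpa [Pi.sub_def] using (h1.sub hlin.continuousWithinAt).tendsto
  · rw [averageCapacity_eq_average_synthesized]
    simp only [sub_mul, Finset.sum_sub_distrib, Finset.sum_add_distrib, ← Finset.sum_mul,
      Finset.sum_const, Finset.card_univ, Fintype.card_fin, nsmul_eq_mul]
    field_simp
    push_cast
    ring

section Fraction

variable {Y : (n : ℕ) → Fin (2 ^ n) → Type*} [∀ n i, Fintype (Y n i)]
  (W : (n : ℕ) → (i : Fin (2 ^ n)) → BDMC (Y n i)) {S : Set ℝ}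

theorem abs_indicator_one_le (S : Set ℝ) (x : ℝ) : |S.indicator (1 : ℝ → ℝ) x| ≤ 1 := by
  simpa using norm_indicator_le_norm_self (s := S) (1 : ℝ → ℝ) x

theorem tendsto_fractionIn_sub_averageCapacity (h1 : S ∈ 𝓝[≤] 1) (h0 : Sᶜ ∈ 𝓝[≥] 0) :
    Tendsto (fun n ↦ fractionIn (W n) S - averageCapacity (W n)) atTop (𝓝 0) := by
  have hone : (1 : ℝ) ∈ S := mem_of_mem_nhdsWithin self_mem_Iic h1
  have hzero : (0 : ℝ) ∉ S := mem_of_mem_nhdsWithin self_mem_Ici h0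
  have hcont0 := continuousWithinAt_indicator_of_compl_mem (1 : ℝ → ℝ) self_mem_Ici h0
  have hcont1 := continuousWithinAt_indicator_of_mem self_mem_Iic h1
    (continuousWithinAt_const (b := (1 : ℝ)))
  simpa [fractionIn_eq_average_indicator, hone, hzero] using
    mainTheorem1_general W (fun x _ ↦ abs_indicator_one_le S x)
      (hcont0.mono Icc_subset_Ici_self) (hcont1.mono Icc_subset_Iic_self)

theorem tendsto_fractionIn_sub_one_sub_averageCapacity (h0 : S ∈ 𝓝[≥] 0) (h1 : Sᶜ ∈ 𝓝[≤] 1) :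
    Tendsto (fun n ↦ fractionIn (W n) S - (1 - averageCapacity (W n))) atTop (𝓝 0) := by
  have hzero : (0 : ℝ) ∈ S := mem_of_mem_nhdsWithin self_mem_Ici h0
  have hone : (1 : ℝ) ∉ S := mem_of_mem_nhdsWithin self_mem_Iic h1
  have hcont0 := continuousWithinAt_indicator_of_mem self_mem_Ici h0
    (continuousWithinAt_const (b := (1 : ℝ)))
  have hcont1 := continuousWithinAt_indicator_of_compl_mem (1 : ℝ → ℝ) self_mem_Iic h1
  simpa [fractionIn_eq_average_indicator, hone, hzero] using
    mainTheorem1_general W (fun x _ ↦ abs_indicator_one_le S x)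
      (hcont0.mono Icc_subset_Ici_self) (hcont1.mono Icc_subset_Iic_self)

end Fraction

end Limit

end IrregularPolar

open IrregularPolar in
theorem mainTheorem1
    (Y : (n : ℕ) → Fin (2 ^ n) → Type*) [∀ n i, Fintype (Y n i)]
    (W : (n : ℕ) → (i : Fin (2 ^ n)) → IrregularPolar.BDMC (Y n i)) :
    (∀ δ : ℝ, 0 < δ → δ < 1 →
      Filter.Tendsto
        (fun n => IrregularPolar.fractionIn (W n) (Set.Ioc (1 - δ) 1)
          - IrregularPolar.averageCapacity (W n))
        Filter.atTop (nhds 0) ∧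
      Filter.Tendsto
        (fun n => IrregularPolar.fractionIn (W n) (Set.Ico 0 δ)
          - (1 - IrregularPolar.averageCapacity (W n)))
        Filter.atTop (nhds 0)) ∧
    (∀ g : ℝ → ℝ, ContinuousOn g (Set.Icc 0 1) →
      Filter.Tendsto
        (fun n => (∑ i, g (IrregularPolar.synthesized (W n) i).symmCapacity) / 2 ^ n
          - (IrregularPolar.averageCapacity (W n) * g 1
            + (1 - IrregularPolar.averageCapacity (W n)) * g 0))
        Filter.atTop (nhds 0)) := by
  refine ⟨fun δ hδ hδ1 ↦ ⟨?_, ?_⟩, fun g hg ↦ ?_⟩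
  · exact tendsto_fractionIn_sub_averageCapacity W (Ioc_mem_nhdsLE (sub_lt_self 1 hδ))
      (Filter.mem_of_superset (Ico_mem_nhdsGE (sub_pos.2 hδ1)) fun _ hx hxS ↦ hxS.1.not_gt hx.2)
  · exact tendsto_fractionIn_sub_one_sub_averageCapacity W (Ico_mem_nhdsGE hδ)
      (Filter.mem_of_superset (Ioc_mem_nhdsLE hδ1) fun _ hx hxS ↦ hxS.2.not_gt hx.1)
  · obtain ⟨M, hM⟩ := isCompact_Icc.exists_bound_of_continuousOn hg
    exact mainTheorem1_general W hM (hg 0 (by simp)) (hg 1 (by simp))
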